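/- Let $(c_n)_{n\ge1}$ be any sequence of positive real numbers with $c_n\to0$. Then there exist a probability space $(\Omega,\mathcal A,\mu)$, a bijective, bimeasurable, measure preserving and ergodic transformation $T:\Omega\to\Omega$, an increasing filtration $(\mathcal F_i)_{i\in\mathbb Z}$ of sub-$\sigma$-algebras of $\mathcal A$ with $T^{-1}\mathcal F_i=\mathcal F_{i+1}$ for all $i$, and an $\mathcal F_0$-measurable function $f:\Omega\to\mathbb R$ with $\int f^2\,d\mu<\infty$ and $\int f\,d\mu=0$ such that, with $S_n(f)=\sum_{i=0}^{n-1}f\circ T^i$ and $\sigma_n^2=\operatorname{Var}(S_n(f))=\|S_n(f)\|_2^2$, $$\sum_{n=1}^\infty c_n\,\frac{\|E(S_n(f)\mid\mathcal F_0)\|_2}{n^{3/2}}<\infty ,$$ the variances grow faster than linearly, that is $\sigma_n^2/n\to\infty$, and there are strictly increasing sequences $(n_k')$, $(n_k'')$ of positive integers and two different probability measures $\nu'\neq\nu''$ on $\mathbb R$ such that the distributions of $S_{n_k'}(f)/\sigma_{n_k'}$ converge weakly to $\nu'$ and those of $S_{n_k''}(f)/\sigma_{n_k''}$ converge weakly to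 $\nu''$. -/

import Mathlib

open MeasureTheory ProbabilityTheory Filter Topology

/-!
The example is a superposition of moving averages living on rapidly separated scales. On the
Bernoulli shift over the array `ω i k` (`i ∈ ℤ`, `k ∈ ℕ`) of independent centered variables of unit
variance, take
`f = ∑ₖ amp k · (1 / N k) ∑_{i < N k} ω (-i) k`, with `amp k = (k + 1)!`,
which is a function of the past.

* In the `n`-th sum the innovations of the `k`-th component at times `0, …, n - N k` all have
  coefficient `amp k`, so by Bessel's inequality the variance is at least `(amp k)² (n - N k)`
  (`le_norm_powSum_superposition_sq`). As `amp k → ∞`, the variance grows faster than linearly.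
* The conditional expectation on the past of the `n`-th sum of the `k`-th component has norm at most
  `amp k · min n (N k) / √(N k)`. After division by `n^{3/2}` these bounds sum to at most `4 amp k`,
  and as `N k` grows their mass moves to large times, where `c` is small. So `N k` can be chosen to
  make the contribution of the `k`-th component to the weighted series at most `2⁻ᵏ`
  (`exists_forall_sum_mul_weight_le`, `summable_proj_powSum_superposition`).
* At the time `((k + 1) N k)²` the whole sum is, up to a relative error `O(1 / k)` in mean square,
  `amp k` times the sum of the innovations of the `k`-th component alone
  (`norm_powSum_superposition_sub_le`). The law of these innovations is still free to depend on that
  time: it is chosen so that their normalized sum has law exactly `N(0, 1)` for even `k`, and exactly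
  that of a Poisson variable of rate one minus its mean for odd `k`, which is possible since both
  laws are infinitely divisible (`isNormalizedRoot_gaussianReal`, `isNormalizedRoot_stdPoisson`).
  Even and odd `k` thus give two different limit laws (`tendstoInDistribution_domTime`).

The estimates take place in a Hilbert space with an orthonormal array `v k i`, an isometry `U`
sending `v k i` to `v k (i + 1)`, and a contraction `P` killing `v k i` for `i > 0`; they are then
applied to the Koopman operator and the conditional expectation.
-/

namespace SlowScale

/-! ### Scales adapted to a null sequence -/

/-- The weight `min n N / (√N n^{3/2})`: up to a constant, an upper bound for the contribution at
time `n` of a normalized moving average of length `N` to the Maxwell-Woodroofe series. -/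
noncomputable def weight (N n : ℕ) : ℝ :=
  min (n : ℝ) N / (√N * (n : ℝ) ^ (3 / 2 : ℝ))

lemma weight_nonneg (N n : ℕ) : 0 ≤ weight N n := by
  unfold weight; positivity

lemma rpow_three_halves {x : ℝ} (hx : 0 ≤ x) : x ^ (3 / 2 : ℝ) = √x ^ 3 := by
  rw [Real.sqrt_eq_rpow, ← Real.rpow_natCast, ← Real.rpow_mul hx]
  norm_num

lemma weight_le_inv_sqrt (N n : ℕ) : weight N (n + 1) ≤ 1 / √N := by
  unfold weight
  have h1 : (1 : ℝ) ≤ √((n + 1 : ℕ) : ℝ) := by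
    rw [Real.one_le_sqrt]; push_cast; linarith [(Nat.cast_nonneg n : (0 : ℝ) ≤ n)]
  rw [rpow_three_halves (by positivity), mul_comm, ← div_div]
  gcongr
  rw [div_le_one (by positivity)]
  refine (min_le_left _ _).trans ?_
  have h2 : √((n + 1 : ℕ) : ℝ) ^ 2 = ((n + 1 : ℕ) : ℝ) := Real.sq_sqrt (by positivity)
  nlinarith [sq_nonneg (√((n + 1 : ℕ) : ℝ))]

/-- The weights of a given length have total mass at most `4`, uniformly in the length. The sum
telescopes against `2 √(m / N)` up to time `N` and against `4 - 2 √(N / m)` afterwards. -/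
lemma sum_weight_le {N : ℕ} (hN : 1 ≤ N) (m : ℕ) :
    ∑ j ∈ Finset.range m, weight N (j + 1) ≤ 4 := by
  have hs : 0 < √(N : ℝ) := Real.sqrt_pos.2 (by exact_mod_cast hN)
  have key : ∑ j ∈ Finset.range m, weight N (j + 1) ≤
      if m ≤ N then 2 * (√m / √N) else 4 - 2 * (√N / √m) := by
    induction m with
    | zero => simp
    | succ m ih =>
      rw [Finset.sum_range_succ]
      have ha2 : √(m : ℝ) ^ 2 = m := Real.sq_sqrt (by positivity)
      have hb2 : √((m + 1 : ℕ) : ℝ) ^ 2 = m + 1 := by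
        rw [Real.sq_sqrt (by positivity)]; push_cast; ring
      have hb : 0 < √((m + 1 : ℕ) : ℝ) := Real.sqrt_pos.2 (by positivity)
      have hab : √(m : ℝ) ≤ √((m + 1 : ℕ) : ℝ) := Real.sqrt_le_sqrt (by push_cast; linarith)
      have ha : 0 ≤ √(m : ℝ) := Real.sqrt_nonneg _
      have hN2 : √(N : ℝ) ^ 2 = N := Real.sq_sqrt (by positivity)
      have hw : weight N (m + 1) =
          min ((m + 1 : ℕ) : ℝ) N / (√N * √((m + 1 : ℕ) : ℝ) ^ 3) := by
        rw [weight, rpow_three_halves (by positivity)]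
      set a := √(m : ℝ)
      set b := √((m + 1 : ℕ) : ℝ)
      set s := √(N : ℝ)
      by_cases h : m + 1 ≤ N
      · rw [if_pos (by omega)] at ih
        rw [if_pos h]
        have h1 : weight N (m + 1) ≤ 2 * ((b - a) / s) := by
          rw [hw, min_eq_left (by exact_mod_cast h)]
          have : ((m + 1 : ℕ) : ℝ) = b ^ 2 := by rw [hb2]; push_cast; ring
          rw [this, show b ^ 2 / (s * b ^ 3) = (1 / b) / s by field_simp,
            show 2 * ((b - a) / s) = (2 * (b - a)) / s by ring]
          gcongr
          rw [div_le_iff₀ hb]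
          nlinarith
        calc _ ≤ 2 * (a / s) + 2 * ((b - a) / s) := add_le_add ih h1
          _ = _ := by ring
      · have hmN : N ≤ m := by omega
        have ha' : 0 < a := Real.sqrt_pos.2 (by exact_mod_cast (by omega : 0 < m))
        have ih' : ∑ j ∈ Finset.range m, weight N (j + 1) ≤ 4 - 2 * (s / a) := by
          rcases hmN.lt_or_eq with h' | h'
          · rwa [if_neg (by omega)] at ih
          · have : a = s := by simp only [a, s, h']
            rw [if_pos (by omega), this, div_self hs.ne'] at ih
            rw [this, div_self hs.ne']; linarith
        rw [if_neg h]
        have h1 : weight N (m + 1) ≤ 2 * (s / a) - 2 * (s / b) := by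
          rw [hw, min_eq_right (by exact_mod_cast (by omega : N ≤ m + 1)), ← hN2]
          rw [show s ^ 2 / (s * b ^ 3) = s * (1 / b ^ 3) by field_simp,
            show 2 * (s / a) - 2 * (s / b) = s * (2 * (b - a) / (a * b)) by field_simp]
          refine mul_le_mul_of_nonneg_left ?_ hs.le
          rw [div_le_div_iff₀ (by positivity) (by positivity)]
          have h2 : (b - a) * (b + a) = 1 := by nlinarith
          have h3 : 1 ≤ 2 * (b - a) * b := by nlinarith
          have h4 : a * b ≤ b ^ 2 := by nlinarith
          nlinarith [sq_nonneg b]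
        linarith
  refine key.trans ?_
  split_ifs with h
  · have : √(m : ℝ) / √N ≤ 1 := by
      rw [div_le_one hs]; exact Real.sqrt_le_sqrt (by exact_mod_cast h)
    linarith
  · have : 0 ≤ √(N : ℝ) / √m := by positivity
    linarith

/-- A Toeplitz lemma for the weights: the `c`-weighted mass of the weights of length `N` tends to
zero as `N` grows, because their mass is bounded and escapes to infinity. -/
lemma exists_forall_sum_mul_weight_le {c : ℕ → ℝ} (hc_pos : ∀ n : ℕ, 1 ≤ n → 0 < c n)
    (hc_lim : Tendsto c atTop (𝓝 0)) {ε : ℝ} (hε : 0 < ε) :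
    ∀ᶠ N : ℕ in atTop, ∀ m, ∑ j ∈ Finset.range m, c (j + 1) * weight N (j + 1) ≤ ε := by
  obtain ⟨M, hM⟩ := eventually_atTop.1 (hc_lim.eventually (gt_mem_nhds (by positivity : 0 < ε / 8)))
  set K := ∑ j ∈ Finset.range M, c (j + 1)
  have hlim : Tendsto (fun N : ℕ => K * (1 / √(N : ℝ))) atTop (𝓝 (K * 0)) := by
    refine Tendsto.const_mul _ ?_
    simp only [one_div]
    exact tendsto_inv_atTop_zero.comp (Real.tendsto_sqrt_atTop.comp tendsto_natCast_atTop_atTop)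
  rw [mul_zero] at hlim
  filter_upwards [hlim.eventually (gt_mem_nhds (by positivity : 0 < ε / 2)),
    eventually_ge_atTop 1] with N hN hN1 m
  have hterm : ∀ j, c (j + 1) * weight N (j + 1) ≤
      (if j < M then c (j + 1) else 0) * (1 / √N) + ε / 8 * weight N (j + 1) := by
    intro j
    have hc := (hc_pos (j + 1) (by omega)).le
    have hw := weight_nonneg N (j + 1)
    split_ifs with h
    · have := mul_le_mul_of_nonneg_left (weight_le_inv_sqrt N j) hc
      have : 0 ≤ ε / 8 * weight N (j + 1) := by positivity
      linarith
    · have := mul_le_mul_of_nonneg_right (hM (j + 1) (by omega)).le hw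
      linarith
  have hK : ∑ j ∈ Finset.range m, (if j < M then c (j + 1) else 0) ≤ K := by
    rw [← Finset.sum_filter]
    refine Finset.sum_le_sum_of_subset_of_nonneg (fun j hj => ?_)
      (fun j _ _ => (hc_pos (j + 1) (by omega)).le)
    simpa using (Finset.mem_filter.1 hj).2
  calc ∑ j ∈ Finset.range m, c (j + 1) * weight N (j + 1)
      ≤ ∑ j ∈ Finset.range m,
        ((if j < M then c (j + 1) else 0) * (1 / √N) + ε / 8 * weight N (j + 1)) :=
        Finset.sum_le_sum fun j _ => hterm j
    _ = (∑ j ∈ Finset.range m, (if j < M then c (j + 1) else 0)) * (1 / √N)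
        + ε / 8 * ∑ j ∈ Finset.range m, weight N (j + 1) := by
        rw [Finset.sum_add_distrib, Finset.sum_mul, Finset.mul_sum]
    _ ≤ K * (1 / √N) + ε / 8 * 4 := by
        gcongr
        exact sum_weight_le hN1 m
    _ ≤ ε := by linarith

/-- The amplitude of the `k`-th component. Factorial growth makes each amplitude dominate the sum
of the preceding ones. -/
noncomputable def amp (k : ℕ) : ℝ := ((k + 1).factorial : ℝ)

lemma amp_pos (k : ℕ) : 0 < amp k := by unfold amp; positivity

lemma sum_amp_le (k : ℕ) : ∑ j ∈ Finset.range k, amp j ≤ 2 / (k + 1) * amp k := by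
  have h : ∑ j ∈ Finset.range k, (j + 1).factorial ≤ 2 * k.factorial := by
    induction k with
    | zero => simp
    | succ k ih =>
      rw [Finset.sum_range_succ]
      have : 2 * k.factorial ≤ (k + 1).factorial ∨ k = 0 := by
        rcases Nat.eq_zero_or_pos k with h | h
        · exact Or.inr h
        · left
          rw [Nat.factorial_succ]
          exact Nat.mul_le_mul_right _ (by omega)
      rcases this with h | rfl
      · omega
      · simp
  have h' : ∑ j ∈ Finset.range k, amp j ≤ 2 * (k.factorial : ℝ) := by
    unfold amp; exact_mod_cast h
  refine h'.trans_eq ?_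
  rw [amp, Nat.factorial_succ]
  push_cast
  field_simp

lemma tendsto_amp : Tendsto amp atTop atTop := by
  refine tendsto_atTop_mono (fun k => ?_) tendsto_natCast_atTop_atTop
  have : k ≤ (k + 1).factorial := (Nat.le_succ k).trans (Nat.self_le_factorial _)
  unfold amp; exact_mod_cast this

/-- The time at which the `k`-th component, a moving average of length `N k`, dominates. Its square
root exceeds the boundary error `2 N k` of the moving average by a factor tending to infinity. -/
def domTime (N : ℕ → ℕ) (k : ℕ) : ℕ := ((k + 1) * N k) ^ 2

/-- Lengths of moving averages that are adapted to the weights `c`: each length is large enough for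
the `k`-th component to have `c`-weighted series at most `2⁻ᵏ`, and to be negligible at the
preceding dominating times. -/
structure AdaptedScales (c : ℕ → ℝ) (N : ℕ → ℕ) : Prop where
  one_le : ∀ k, 1 ≤ N k
  domTime_lt : ∀ k, domTime N k < N (k + 1)
  sum_le : ∀ k m, amp k * ∑ j ∈ Finset.range m, c (j + 1) * weight (N k) (j + 1) ≤ (1 / 2) ^ k
  amp_zero_le : amp 0 ≤ √(N 0)
  amp_succ_le : ∀ k, amp (k + 1) * domTime N k ≤ (1 / 2) ^ (k + 1) * √(N (k + 1))

lemma exists_adaptedScales {c : ℕ → ℝ} (hc_pos : ∀ n : ℕ, 1 ≤ n → 0 < c n)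
    (hc_lim : Tendsto c atTop (𝓝 0)) : ∃ N, AdaptedScales c N := by
  have H : ∀ k M : ℕ, ∃ N : ℕ, 1 ≤ N ∧ M < N ∧
      (∀ m, amp k * ∑ j ∈ Finset.range m, c (j + 1) * weight N (j + 1) ≤ (1 / 2) ^ k) ∧
      amp k * M ≤ (1 / 2) ^ k * √N := by
    intro k M
    have h1 := exists_forall_sum_mul_weight_le hc_pos hc_lim
      (div_pos (by positivity : (0 : ℝ) < (1 / 2) ^ k) (amp_pos k))
    have h2 : Tendsto (fun N : ℕ => (1 / 2 : ℝ) ^ k * √N) atTop atTop :=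
      (Real.tendsto_sqrt_atTop.comp tendsto_natCast_atTop_atTop).const_mul_atTop (by positivity)
    obtain ⟨N, hN1, hN2, hN3, hN4⟩ := (h1.and ((h2.eventually_ge_atTop (amp k * M)).and
      ((eventually_ge_atTop 1).and (eventually_gt_atTop M)))).exists
    refine ⟨N, hN3, hN4, fun m => ?_, hN2⟩
    have := hN1 m
    rwa [le_div_iff₀ (amp_pos k), mul_comm] at this
  choose g hg1 hg2 hg3 hg4 using H
  let N : ℕ → ℕ := fun k => Nat.rec (g 0 1) (fun k r => g (k + 1) (((k + 1) * r) ^ 2)) k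
  have hN : ∀ k, N (k + 1) = g (k + 1) (domTime N k) := fun k => rfl
  refine ⟨N, ?_, ?_, ?_, ?_, ?_⟩
  · rintro (_ | k)
    · exact hg1 _ _
    · rw [hN]; exact hg1 _ _
  · intro k; rw [hN]; exact hg2 _ _
  · rintro (_ | k)
    · exact hg3 _ _
    · rw [hN]; exact hg3 _ _
  · change amp 0 ≤ √(g 0 1 : ℝ)
    simpa using hg4 0 1
  · intro k; rw [hN]; exact hg4 _ _

namespace AdaptedScales

variable {c : ℕ → ℝ} {N : ℕ → ℕ}

lemma le_domTime (h : AdaptedScales c N) (k : ℕ) : N k ≤ domTime N k := by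
  have := h.one_le k
  unfold domTime
  nlinarith [Nat.zero_le k, Nat.zero_le (k * N k)]

lemma domTime_pos (h : AdaptedScales c N) (k : ℕ) : 0 < domTime N k :=
  (h.one_le k).trans (h.le_domTime k)

lemma strictMono_domTime (h : AdaptedScales c N) : StrictMono (domTime N) :=
  strictMono_nat_of_lt_succ fun k => (h.domTime_lt k).trans_le (h.le_domTime (k + 1))

lemma amp_div_sqrt_le (h : AdaptedScales c N) (k : ℕ) : amp k / √(N k) ≤ (1 / 2) ^ k := by
  rw [div_le_iff₀ (Real.sqrt_pos.2 (by exact_mod_cast h.one_le k))]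
  rcases k with _ | k
  · simpa using h.amp_zero_le
  · refine le_trans ?_ (h.amp_succ_le k)
    have : (1 : ℝ) ≤ domTime N k := by exact_mod_cast h.domTime_pos k
    nlinarith [amp_pos (k + 1)]

lemma domTime_mul_amp_div_sqrt_le (h : AdaptedScales c N) {k j : ℕ} (hkj : k < j) :
    domTime N k * (amp j / √(N j)) ≤ (1 / 2) ^ j := by
  obtain ⟨i, rfl⟩ : ∃ i, j = i + 1 := ⟨j - 1, by omega⟩
  rw [← mul_div_assoc, div_le_iff₀ (Real.sqrt_pos.2 (by exact_mod_cast h.one_le _))]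
  refine le_trans ?_ (h.amp_succ_le i)
  rw [mul_comm]
  have : (domTime N k : ℝ) ≤ domTime N i := by
    exact_mod_cast h.strictMono_domTime.monotone (by omega : k ≤ i)
  have := amp_pos (i + 1)
  gcongr

lemma sqrt_domTime (k : ℕ) : √(domTime N k : ℝ) = (k + 1) * N k := by
  rw [domTime]
  push_cast
  exact Real.sqrt_sq (by positivity)

end AdaptedScales

/-! ### Moving averages in a Hilbert space -/

section Hilbert

variable {H : Type*} [NormedAddCommGroup H] [InnerProductSpace ℝ H]

/-- The partial sum `1 + U + ⋯ + U^(n-1)` of the powers of an operator. -/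
noncomputable def powSum (U : H →L[ℝ] H) (n : ℕ) : H →L[ℝ] H := ∑ l ∈ Finset.range n, U ^ l

lemma powSum_apply (U : H →L[ℝ] H) (n : ℕ) (x : H) :
    powSum U n x = ∑ l ∈ Finset.range n, (U ^ l) x := by
  simp [powSum]

lemma norm_pow_apply {U : H →L[ℝ] H} (hU : ∀ x, ‖U x‖ = ‖x‖) (l : ℕ) (x : H) :
    ‖(U ^ l) x‖ = ‖x‖ := by
  induction l with
  | zero => simp
  | succ l ih => rw [pow_succ', mul_apply_eq_comp, hU, ih]

/-- The one-sided moving average of length `N` of a bi-infinite sequence, at time `0`. -/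
noncomputable def movAvg (w : ℤ → H) (N : ℕ) : H :=
  (N : ℝ)⁻¹ • ∑ i ∈ Finset.range N, w (-(i : ℤ))

lemma norm_sum_orthonormal {ι : Type*} {w : ι → H} (hw : Orthonormal ℝ w) (s : Finset ι) :
    ‖∑ i ∈ s, w i‖ = √(s.card : ℝ) := by
  have h : ‖∑ i ∈ s, w i‖ ^ 2 = s.card := by
    have := hw.inner_sum (fun _ => (1 : ℝ)) (fun _ => 1) s
    simp only [one_smul, map_one, mul_one, Finset.sum_const, nsmul_eq_mul] at this
    rw [← real_inner_self_eq_norm_sq, this]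
  rw [← h, Real.sqrt_sq (norm_nonneg _)]

section Chain

variable {w : ℤ → H} {U : H →L[ℝ] H}

lemma pow_apply_shift (hU : ∀ i, U (w i) = w (i + 1)) (l : ℕ) (i : ℤ) :
    (U ^ l) (w i) = w (i + l) := by
  induction l with
  | zero => simp
  | succ l ih =>
    rw [pow_succ', mul_apply_eq_comp, ih, hU]
    congr 1; push_cast; ring

lemma powSum_shift (hU : ∀ i, U (w i) = w (i + 1)) (n : ℕ) (i : ℤ) :
    powSum U n (w i) = ∑ l ∈ Finset.range n, w (i + l) := by
  simp [powSum_apply, pow_apply_shift hU]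

lemma norm_powSum_shift (hw : Orthonormal ℝ w) (hU : ∀ i, U (w i) = w (i + 1)) (n : ℕ) (i : ℤ) :
    ‖powSum U n (w i)‖ = √n := by
  have h : Orthonormal ℝ (fun l : ℕ => w (i + l)) :=
    hw.comp (fun l : ℕ => i + (l : ℤ)) fun a b h => by simpa using h
  rw [powSum_shift hU, norm_sum_orthonormal h, Finset.card_range]

lemma norm_movAvg (hw : Orthonormal ℝ w) (N : ℕ) : ‖movAvg w N‖ = 1 / √N := by
  have h : Orthonormal ℝ (fun i : ℕ => w (-(i : ℤ))) :=
    hw.comp (fun i : ℕ => -(i : ℤ)) fun a b h => by simpa using h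
  rw [movAvg, norm_smul, norm_sum_orthonormal h, Finset.card_range, norm_inv, Real.norm_natCast,
    inv_mul_eq_div, Real.sqrt_div_self']

lemma powSum_movAvg (N n : ℕ) :
    powSum U n (movAvg w N) =
      (N : ℝ)⁻¹ • ∑ i ∈ Finset.range N, powSum U n (w (-(i : ℤ))) := by
  rw [movAvg, map_smul, map_sum]

lemma norm_inv_smul_sum_le {N : ℕ} {C : ℝ} (hC : 0 ≤ C) {x : ℕ → H}
    (hx : ∀ i < N, ‖x i‖ ≤ C) : ‖(N : ℝ)⁻¹ • ∑ i ∈ Finset.range N, x i‖ ≤ C := by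
  rw [norm_smul, norm_inv, Real.norm_natCast]
  have h : ‖∑ i ∈ Finset.range N, x i‖ ≤ N * C := by
    refine (norm_sum_le _ _).trans ?_
    refine (Finset.sum_le_sum fun i hi => hx i (Finset.mem_range.1 hi)).trans_eq ?_
    simp
  rcases N.eq_zero_or_pos with rfl | hN
  · simpa using hC
  · rw [inv_mul_le_iff₀ (by exact_mod_cast hN)]
    exact h

lemma norm_powSum_movAvg_le (hw : Orthonormal ℝ w) (hU : ∀ i, U (w i) = w (i + 1)) (N n : ℕ) :
    ‖powSum U n (movAvg w N)‖ ≤ √n := by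
  rw [powSum_movAvg]
  exact norm_inv_smul_sum_le (Real.sqrt_nonneg _) fun i _ => (norm_powSum_shift hw hU n _).le

/-- Shifting a window of orthonormal vectors by `i` changes its sum by at most `2 i`. -/
lemma norm_powSum_shift_sub_le (hw : Orthonormal ℝ w) (hU : ∀ i, U (w i) = w (i + 1)) (n i : ℕ) :
    ‖powSum U n (w (-(i : ℤ))) - powSum U n (w 0)‖ ≤ 2 * i := by
  induction i with
  | zero => simp
  | succ i ih =>
    have h1 : powSum U n (w (-((i + 1 : ℕ) : ℤ))) - powSum U n (w (-(i : ℤ))) =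
        w (-((i + 1 : ℕ) : ℤ)) - w (-((i + 1 : ℕ) : ℤ) + n) := by
      rw [powSum_shift hU, powSum_shift hU, ← Finset.sum_sub_distrib]
      have := Finset.sum_range_sub' (fun l : ℕ => w (-((i + 1 : ℕ) : ℤ) + l)) n
      simp only [Nat.cast_zero, add_zero] at this
      rw [← this]
      refine Finset.sum_congr rfl fun l _ => ?_
      congr 2
      push_cast; ring
    have h2 : ‖w (-((i + 1 : ℕ) : ℤ)) - w (-((i + 1 : ℕ) : ℤ) + n)‖ ≤ 2 := by
      refine (norm_sub_le _ _).trans ?_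
      rw [hw.norm_eq_one, hw.norm_eq_one]; norm_num
    calc _ ≤ ‖powSum U n (w (-((i + 1 : ℕ) : ℤ))) - powSum U n (w (-(i : ℤ)))‖
          + ‖powSum U n (w (-(i : ℤ))) - powSum U n (w 0)‖ := norm_sub_le_norm_sub_add_norm_sub _ _ _
      _ ≤ 2 + 2 * i := by rw [h1]; exact add_le_add h2 ih
      _ = _ := by push_cast; ring

/-- Sums of a moving average over times much longer than its length are close to sums of the
underlying orthonormal sequence. -/
lemma norm_powSum_movAvg_sub_le (hw : Orthonormal ℝ w) (hU : ∀ i, U (w i) = w (i + 1))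
    {N : ℕ} (hN : 1 ≤ N) (n : ℕ) :
    ‖powSum U n (movAvg w N) - powSum U n (w 0)‖ ≤ 2 * N := by
  have h : powSum U n (movAvg w N) - powSum U n (w 0) =
      (N : ℝ)⁻¹ • ∑ i ∈ Finset.range N, (powSum U n (w (-(i : ℤ))) - powSum U n (w 0)) := by
    rw [powSum_movAvg, Finset.sum_sub_distrib, smul_sub, Finset.sum_const, Finset.card_range,
      ← Nat.cast_smul_eq_nsmul ℝ, smul_smul, inv_mul_cancel₀ (by positivity), one_smul]
  rw [h]
  refine norm_inv_smul_sum_le (by positivity) fun i hi => ?_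
  refine (norm_powSum_shift_sub_le hw hU n i).trans ?_
  have : (i : ℝ) ≤ N := by exact_mod_cast hi.le
  linarith

/-- If `P` kills the future of the sequence, then after the first `N` steps the orbit of a moving
average of length `N` is killed by `P`. -/
lemma norm_proj_powSum_movAvg_le (hw : Orthonormal ℝ w) (hU : ∀ i, U (w i) = w (i + 1))
    (hU1 : ∀ x, ‖U x‖ = ‖x‖) {P : H →L[ℝ] H} (hP1 : ∀ x, ‖P x‖ ≤ ‖x‖)
    (hP : ∀ i, 0 < i → P (w i) = 0) (N n : ℕ) :
    ‖P (powSum U n (movAvg w N))‖ ≤ min (n : ℝ) N / √N := by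
  have hterm : ∀ l : ℕ, ‖P ((U ^ l) (movAvg w N))‖ ≤ if l < N then 1 / √N else 0 := by
    intro l
    split_ifs with hl
    · exact (hP1 _).trans_eq (by rw [norm_pow_apply hU1, norm_movAvg hw])
    · rw [movAvg, map_smul, map_sum, map_smul, map_sum, Finset.sum_eq_zero, smul_zero, norm_zero]
      intro i hi
      rw [pow_apply_shift hU]
      exact hP _ (by have := Finset.mem_range.1 hi; omega)
  rw [powSum_apply, map_sum]
  refine (norm_sum_le _ _).trans ((Finset.sum_le_sum fun l _ => hterm l).trans_eq ?_)
  rw [← Finset.sum_filter, Finset.sum_const, nsmul_eq_mul, mul_one_div]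
  congr 1
  have : (Finset.range n).filter (· < N) = Finset.range (min n N) := by
    ext; simp
  rw [this, Finset.card_range, Nat.cast_min]

end Chain

section System

variable {v : ℕ → ℤ → H} {U P : H →L[ℝ] H} {c : ℕ → ℝ} {N : ℕ → ℕ}

lemma orthonormal_row (hv : Orthonormal ℝ (fun p : ℕ × ℤ => v p.1 p.2)) (k : ℕ) :
    Orthonormal ℝ (v k) :=
  hv.comp (fun i : ℤ => (k, i)) fun a b h => by simpa using h

/-- The superposition `∑ₖ amp k • movAvg (v k) (N k)`. -/
noncomputable def superposition (v : ℕ → ℤ → H) (N : ℕ → ℕ) : H :=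
  ∑' k, amp k • movAvg (v k) (N k)

lemma summable_norm_components (hv : Orthonormal ℝ (fun p : ℕ × ℤ => v p.1 p.2))
    (hN : AdaptedScales c N) : Summable fun k => ‖amp k • movAvg (v k) (N k)‖ := by
  refine Summable.of_nonneg_of_le (fun _ => norm_nonneg _) (fun k => ?_) summable_geometric_two
  rw [norm_smul, norm_movAvg (orthonormal_row hv k), Real.norm_of_nonneg (amp_pos k).le,
    mul_one_div]
  exact hN.amp_div_sqrt_le k

variable [CompleteSpace H]

lemma hasSum_superposition (hv : Orthonormal ℝ (fun p : ℕ × ℤ => v p.1 p.2))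
    (hN : AdaptedScales c N) :
    HasSum (fun k => amp k • movAvg (v k) (N k)) (superposition v N) :=
  (summable_norm_components hv hN).of_norm.hasSum

lemma hasSum_powSum_superposition (hv : Orthonormal ℝ (fun p : ℕ × ℤ => v p.1 p.2))
    (hN : AdaptedScales c N) (n : ℕ) :
    HasSum (fun k => amp k • powSum U n (movAvg (v k) (N k)))
      (powSum U n (superposition v N)) := by
  have := (powSum U n).hasSum (hasSum_superposition hv hN)
  simpa only [map_smul] using this

/-- Each innovation at a time in the bulk of `[0, n)` is used by all the `N k` terms of its moving
average, so its coefficient in the `n`-th sum is the full amplitude. -/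
lemma inner_powSum_superposition (hv : Orthonormal ℝ (fun p : ℕ × ℤ => v p.1 p.2))
    (hU : ∀ k i, U (v k i) = v k (i + 1)) (hN : AdaptedScales c N) {k n m : ℕ}
    (hm : m + N k ≤ n) :
    inner ℝ (v k m) (powSum U n (superposition v N)) = amp k := by
  have h := (innerSL ℝ (v k m)).hasSum (hasSum_powSum_superposition (U := U) hv hN n)
  simp only [innerSL_apply_apply] at h
  have hcoef : ∀ j, inner ℝ (v k m) (amp j • powSum U n (movAvg (v j) (N j))) =
      if j = k then amp k else 0 := by
    intro j
    have horth : ∀ i : ℤ, inner ℝ (v k m) (v j i) = if (k, (m : ℤ)) = (j, i) then (1 : ℝ) else 0 :=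
      fun i => orthonormal_iff_ite.1 hv (k, m) (j, i)
    rw [inner_smul_right, powSum_movAvg, inner_smul_right, inner_sum]
    simp only [powSum_shift (hU j), inner_sum, horth]
    split_ifs with hjk
    · subst hjk
      have : ∀ i ∈ Finset.range (N j), (∑ l ∈ Finset.range n,
          if (j, (m : ℤ)) = (j, -(i : ℤ) + l) then (1 : ℝ) else 0) = 1 := by
        intro i hi
        have hi' := Finset.mem_range.1 hi
        rw [Finset.sum_eq_single_of_mem (m + i) (Finset.mem_range.2 (by omega))]
        · rw [if_pos]; simp
        · intro l _ hl
          rw [if_neg]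
          simp only [Prod.mk.injEq, true_and]
          omega
      rw [Finset.sum_congr rfl this]
      have hN0 : (N j : ℝ) ≠ 0 := by have := hN.one_le j; positivity
      simp [hN0]
    · have : ∀ i ∈ Finset.range (N j), (∑ l ∈ Finset.range n,
          if (k, (m : ℤ)) = (j, -(i : ℤ) + l) then (1 : ℝ) else 0) = 0 := by
        intro i _
        refine Finset.sum_eq_zero fun l _ => if_neg ?_
        simp [Ne.symm hjk]
      rw [Finset.sum_congr rfl this]
      simp
  simp only [hcoef] at h
  exact h.unique (hasSum_ite_eq k (amp k))

/-- Bessel's inequality against the innovations of the `k`-th component in the bulk of `[0, n)`. -/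
lemma le_norm_powSum_superposition_sq (hv : Orthonormal ℝ (fun p : ℕ × ℤ => v p.1 p.2))
    (hU : ∀ k i, U (v k i) = v k (i + 1)) (hN : AdaptedScales c N) (k n : ℕ) :
    amp k ^ 2 * ((n : ℝ) - N k) ≤ ‖powSum U n (superposition v N)‖ ^ 2 := by
  rcases le_or_gt (N k) n with hn | hn
  · have h : Orthonormal ℝ (fun m : ℕ => v k m) :=
      (orthonormal_row hv k).comp (fun m : ℕ => (m : ℤ)) Nat.cast_injective
    refine le_trans ?_ (h.sum_inner_products_le (powSum U n (superposition v N))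
      (s := Finset.range (n - N k)))
    rw [Finset.sum_congr rfl fun m hm => by
      rw [inner_powSum_superposition hv hU hN (by have := Finset.mem_range.1 hm; omega)]]
    rw [Finset.sum_const, Finset.card_range, nsmul_eq_mul, Nat.cast_sub hn,
      Real.norm_of_nonneg (amp_pos k).le, mul_comm]
  · have h1 : (n : ℝ) - N k ≤ 0 := by
      have : (n : ℝ) ≤ N k := by exact_mod_cast hn.le
      linarith
    nlinarith [sq_nonneg (amp k), sq_nonneg ‖powSum U n (superposition v N)‖]

lemma tendsto_norm_powSum_superposition_sq_div
    (hv : Orthonormal ℝ (fun p : ℕ × ℤ => v p.1 p.2))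
    (hU : ∀ k i, U (v k i) = v k (i + 1)) (hN : AdaptedScales c N) :
    Tendsto (fun n : ℕ => ‖powSum U n (superposition v N)‖ ^ 2 / n) atTop atTop := by
  rw [tendsto_atTop]
  intro b
  obtain ⟨k, hk⟩ := (tendsto_amp.eventually_ge_atTop (2 * |b| + 1)).exists
  filter_upwards [eventually_ge_atTop (2 * N k), eventually_ge_atTop 1] with n hn hn1
  have hn0 : (0 : ℝ) < n := by exact_mod_cast hn1
  rw [le_div_iff₀ hn0]
  refine le_trans ?_ (le_norm_powSum_superposition_sq hv hU hN k n)
  have h1 : (2 : ℝ) * N k ≤ n := by exact_mod_cast hn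
  have h2 : 2 * |b| ≤ amp k ^ 2 := by nlinarith [abs_nonneg b]
  have h3 : (n : ℝ) / 2 ≤ n - N k := by linarith
  calc b * n ≤ (2 * |b|) * (n / 2) := by nlinarith [le_abs_self b]
    _ ≤ amp k ^ 2 * ((n : ℝ) - N k) := by gcongr

lemma norm_proj_powSum_superposition_le (hv : Orthonormal ℝ (fun p : ℕ × ℤ => v p.1 p.2))
    (hU : ∀ k i, U (v k i) = v k (i + 1)) (hU1 : ∀ x, ‖U x‖ = ‖x‖) (hP1 : ∀ x, ‖P x‖ ≤ ‖x‖)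
    (hP : ∀ k i, 0 < i → P (v k i) = 0) (hN : AdaptedScales c N) (n : ℕ) :
    Summable (fun k => amp k * (min (n : ℝ) (N k) / √(N k))) ∧
    ‖P (powSum U n (superposition v N))‖ ≤ ∑' k, amp k * (min (n : ℝ) (N k) / √(N k)) := by
  have hs : Summable (fun k => amp k * (min (n : ℝ) (N k) / √(N k))) := by
    refine Summable.of_nonneg_of_le (fun k => ?_) (fun k => ?_)
      (summable_geometric_two.mul_left (n : ℝ))
    · have := amp_pos k; positivity
    · have h1 := hN.amp_div_sqrt_le k
      have h2 : min (n : ℝ) (N k) ≤ n := min_le_left _ _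
      have h3 := amp_pos k
      calc amp k * (min (n : ℝ) (N k) / √(N k)) = min (n : ℝ) (N k) * (amp k / √(N k)) := by ring
        _ ≤ n * (1 / 2) ^ k := by gcongr
  refine ⟨hs, ?_⟩
  have h := P.hasSum (hasSum_powSum_superposition (U := U) hv hN n)
  rw [← h.tsum_eq]
  refine tsum_of_norm_bounded hs.hasSum fun k => ?_
  rw [map_smul, norm_smul, Real.norm_of_nonneg (amp_pos k).le]
  exact mul_le_mul_of_nonneg_left (norm_proj_powSum_movAvg_le (orthonormal_row hv k) (hU k) hU1 hP1
    (hP k) (N k) n) (amp_pos k).le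

/-- The weighted Maxwell-Woodroofe series of the superposition converges: exchanging the two sums,
the `k`-th component contributes at most `2⁻ᵏ`. -/
lemma summable_proj_powSum_superposition (hv : Orthonormal ℝ (fun p : ℕ × ℤ => v p.1 p.2))
    (hU : ∀ k i, U (v k i) = v k (i + 1)) (hU1 : ∀ x, ‖U x‖ = ‖x‖) (hP1 : ∀ x, ‖P x‖ ≤ ‖x‖)
    (hP : ∀ k i, 0 < i → P (v k i) = 0) (hN : AdaptedScales c N)
    (hc_pos : ∀ n : ℕ, 1 ≤ n → 0 < c n) :
    Summable (fun n : ℕ => c (n + 1) * (‖P (powSum U (n + 1) (superposition v N))‖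
      / ((n + 1 : ℕ) : ℝ) ^ (3 / 2 : ℝ))) := by
  have hc : ∀ n, 0 ≤ c (n + 1) := fun n => (hc_pos _ (by omega)).le
  refine summable_of_sum_range_le (c := 2) (fun n => mul_nonneg (hc n) (by positivity))
    fun m => ?_
  have hterm : ∀ n : ℕ, Summable (fun k => amp k * (c (n + 1) * weight (N k) (n + 1))) ∧
      c (n + 1) * (‖P (powSum U (n + 1) (superposition v N))‖
      / ((n + 1 : ℕ) : ℝ) ^ (3 / 2 : ℝ)) ≤
      ∑' k, amp k * (c (n + 1) * weight (N k) (n + 1)) := by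
    intro n
    obtain ⟨h1, h2⟩ := norm_proj_powSum_superposition_le hv hU hU1 hP1 hP hN (n + 1)
    have heq : (fun k => amp k * (c (n + 1) * weight (N k) (n + 1))) = fun k =>
        (c (n + 1) / ((n + 1 : ℕ) : ℝ) ^ (3 / 2 : ℝ)) *
          (amp k * (min ((n + 1 : ℕ) : ℝ) (N k) / √(N k))) := by
      ext k
      rw [weight, ← div_div]
      ring
    rw [heq]
    refine ⟨h1.mul_left _, ?_⟩
    rw [tsum_mul_left, ← mul_div_assoc, mul_div_right_comm]
    exact mul_le_mul_of_nonneg_left h2 (div_nonneg (hc n) (by positivity))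
  calc _ ≤ ∑ n ∈ Finset.range m, ∑' k, amp k * (c (n + 1) * weight (N k) (n + 1)) :=
        Finset.sum_le_sum fun n _ => (hterm n).2
    _ = ∑' k, ∑ n ∈ Finset.range m, amp k * (c (n + 1) * weight (N k) (n + 1)) :=
        (Summable.tsum_finsetSum fun n _ => (hterm n).1).symm
    _ ≤ ∑' k : ℕ, (1 / 2 : ℝ) ^ k := by
        refine Summable.tsum_le_tsum (fun k => ?_) (summable_sum fun n _ => (hterm n).1)
          summable_geometric_two
        rw [← Finset.mul_sum]
        exact hN.sum_le k m
    _ = 2 := tsum_geometric_two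

/-- At its dominating time, the `k`-th component carries the whole sum up to a relative error
`6 / (k + 1)`: the earlier components have smaller amplitudes, the later ones are too small to
matter yet, and the `k`-th moving average is close to the sum of its innovations. -/
lemma norm_powSum_superposition_sub_le (hv : Orthonormal ℝ (fun p : ℕ × ℤ => v p.1 p.2))
    (hU : ∀ k i, U (v k i) = v k (i + 1)) (hU1 : ∀ x, ‖U x‖ = ‖x‖) (hN : AdaptedScales c N)
    (k : ℕ) :
    ‖powSum U (domTime N k) (superposition v N) - amp k • powSum U (domTime N k) (v k 0)‖ ≤
      6 / (k + 1) * (amp k * √(domTime N k)) := by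
  set n := domTime N k
  have hN0 : (1 : ℝ) ≤ N k := by exact_mod_cast hN.one_le k
  have hsqrt : √(n : ℝ) = (k + 1) * N k := AdaptedScales.sqrt_domTime k
  set x : ℕ → H := fun j => amp j • powSum U n (movAvg (v j) (N j)) with hx
  have hsum := hasSum_powSum_superposition (U := U) hv hN n
  have hsplit : powSum U n (superposition v N) =
      (∑ j ∈ Finset.range k, x j) + x k + ∑' j, x (j + (k + 1)) := by
    rw [← hsum.tsum_eq, ← hsum.summable.sum_add_tsum_nat_add (k + 1), Finset.sum_range_succ]
  have h1 : ‖∑ j ∈ Finset.range k, x j‖ ≤ 2 / (k + 1) * (amp k * √n) := by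
    calc _ ≤ ∑ j ∈ Finset.range k, amp j * √n := by
          refine norm_sum_le_of_le _ fun j _ => ?_
          rw [hx, norm_smul, Real.norm_of_nonneg (amp_pos j).le]
          exact mul_le_mul_of_nonneg_left
            (norm_powSum_movAvg_le (orthonormal_row hv j) (hU j) _ _) (amp_pos j).le
      _ ≤ (2 / (k + 1) * amp k) * √n := by
          rw [← Finset.sum_mul]
          exact mul_le_mul_of_nonneg_right (sum_amp_le k) (Real.sqrt_nonneg _)
      _ = _ := by ring
  have h2 : ‖x k - amp k • powSum U n (v k 0)‖ ≤ 2 / (k + 1) * (amp k * √n) := by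
    rw [hx, ← smul_sub, norm_smul, Real.norm_of_nonneg (amp_pos k).le, hsqrt]
    refine (mul_le_mul_of_nonneg_left (norm_powSum_movAvg_sub_le (orthonormal_row hv k) (hU k)
      (hN.one_le k) n) (amp_pos k).le).trans_eq ?_
    field_simp
  have h3 : ‖∑' j, x (j + (k + 1))‖ ≤ 2 / (k + 1) * (amp k * √n) := by
    have hb : ∀ j, ‖x (j + (k + 1))‖ ≤ (1 / 2 : ℝ) ^ j := by
      intro j
      have hle : ‖powSum U n (movAvg (v (j + (k + 1))) (N (j + (k + 1))))‖ ≤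
          n * (1 / √(N (j + (k + 1)))) := by
        rw [powSum_apply]
        refine (norm_sum_le _ _).trans_eq ?_
        rw [Finset.sum_congr rfl fun l _ => by
          rw [norm_pow_apply hU1, norm_movAvg (orthonormal_row hv _)]]
        simp
      have hpos := amp_pos (j + (k + 1))
      calc ‖x (j + (k + 1))‖ ≤ amp (j + (k + 1)) * (n * (1 / √(N (j + (k + 1))))) := by
            rw [hx, norm_smul, Real.norm_of_nonneg hpos.le]
            exact mul_le_mul_of_nonneg_left hle hpos.le
        _ = n * (amp (j + (k + 1)) / √(N (j + (k + 1)))) := by ring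
        _ ≤ (1 / 2) ^ (j + (k + 1)) := hN.domTime_mul_amp_div_sqrt_le (by omega)
        _ ≤ (1 / 2) ^ j := pow_le_pow_of_le_one (by norm_num) (by norm_num) (by omega)
    refine (tsum_of_norm_bounded hasSum_geometric_two hb).trans ?_
    have hamp : (1 : ℝ) ≤ amp k := by
      unfold amp; exact_mod_cast (k + 1).factorial_pos
    rw [hsqrt, show 2 / ((k : ℝ) + 1) * (amp k * ((k + 1) * N k)) = 2 * (amp k * N k) by field_simp]
    nlinarith
  have hfinal : powSum U n (superposition v N) - amp k • powSum U n (v k 0) =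
      (∑ j ∈ Finset.range k, x j) + (x k - amp k • powSum U n (v k 0))
        + ∑' j, x (j + (k + 1)) := by
    rw [hsplit]; abel
  rw [hfinal]
  refine (norm_add₃_le).trans ?_
  calc _ ≤ 2 / (k + 1) * (amp k * √n) + 2 / (k + 1) * (amp k * √n)
        + 2 / (k + 1) * (amp k * √n) := by gcongr
    _ = _ := by ring

end System

end Hilbert

/-! ### Convolution roots of the normal and the centered Poisson law -/

/-- `ρ` is centered with unit variance, and the sum of `n` independent variables of law `ρ`, divided
by `√n`, has law `ν`. The latter is expressed through characteristic functions. -/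
structure IsNormalizedRoot (n : ℕ) (ρ ν : Measure ℝ) : Prop where
  isProbabilityMeasure : IsProbabilityMeasure ρ
  memLp : MemLp id 2 ρ
  integral_id : ∫ x, x ∂ρ = 0
  integral_sq : ∫ x, x ^ 2 ∂ρ = 1
  charFun_pow : ∀ t : ℝ, charFun ρ ((√n)⁻¹ * t) ^ n = charFun ν t

lemma isNormalizedRoot_gaussianReal {n : ℕ} (hn : 0 < n) :
    IsNormalizedRoot n (gaussianReal 0 1) (gaussianReal 0 1) where
  isProbabilityMeasure := inferInstance
  memLp := memLp_id_gaussianReal 2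
  integral_id := integral_id_gaussianReal
  integral_sq := by
    have h := variance_id_gaussianReal (μ := 0) (v := 1)
    rw [variance_eq_integral (by fun_prop)] at h
    simpa [integral_id_gaussianReal] using h
  charFun_pow t := by
    have h : ((√(n : ℝ) : ℝ) : ℂ) ^ 2 = n := by
      rw [← Complex.ofReal_pow, Real.sq_sqrt (by positivity)]; simp
    have hn' : (n : ℂ) ≠ 0 := by exact_mod_cast hn.ne'
    rw [charFun_gaussianReal, charFun_gaussianReal, ← Complex.exp_nat_mul]
    congr 1
    push_cast
    rw [mul_pow, inv_pow, h, mul_zero, mul_zero, zero_mul]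
    field_simp
    ring

lemma hasSum_poisson_moment_one (r : ℝ) :
    HasSum (fun k : ℕ => Real.exp (-r) * r ^ k / k.factorial * k) r := by
  rw [← hasSum_nat_add_iff' 1]
  have h := (NormedSpace.expSeries_div_hasSum_exp r).mul_left (Real.exp (-r) * r)
  rw [← congrFun Real.exp_eq_exp_ℝ r] at h
  have hv : r - ∑ i ∈ Finset.range 1, Real.exp (-r) * r ^ i / i.factorial * (i : ℝ) =
      Real.exp (-r) * r * Real.exp r := by
    rw [mul_right_comm, ← Real.exp_add]; simp
  rw [hv]
  refine h.congr_fun fun k => ?_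
  rw [Nat.factorial_succ]
  push_cast
  field_simp
  ring

lemma hasSum_poisson_moment_two (r : ℝ) :
    HasSum (fun k : ℕ => Real.exp (-r) * r ^ k / k.factorial * (k : ℝ) ^ 2) (r ^ 2 + r) := by
  rw [← hasSum_nat_add_iff' 1]
  have h := (NormedSpace.expSeries_div_hasSum_exp r).mul_left (Real.exp (-r) * r)
  rw [← congrFun Real.exp_eq_exp_ℝ r] at h
  have h' := (hasSum_poisson_moment_one r).mul_left r
  have hv : r ^ 2 + r - ∑ i ∈ Finset.range 1, Real.exp (-r) * r ^ i / i.factorial * (i : ℝ) ^ 2 =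
      r * r + Real.exp (-r) * r * Real.exp r := by
    rw [mul_right_comm, ← Real.exp_add]; simp; ring
  rw [hv]
  refine (h'.add h).congr_fun fun k => ?_
  rw [Nat.factorial_succ]
  push_cast
  field_simp
  ring

open scoped NNReal

lemma integrable_poisson_id (r : ℝ≥0) : Integrable (fun k : ℕ => (k : ℝ)) (poissonMeasure r) := by
  rw [integrable_poissonMeasure_iff]
  simpa using (hasSum_poisson_moment_one r).summable

lemma integrable_poisson_sq (r : ℝ≥0) :
    Integrable (fun k : ℕ => (k : ℝ) ^ 2) (poissonMeasure r) := by
  rw [integrable_poissonMeasure_iff]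
  simpa using (hasSum_poisson_moment_two r).summable

lemma integral_poisson_id (r : ℝ≥0) : ∫ k : ℕ, (k : ℝ) ∂(poissonMeasure r) = r := by
  rw [integral_poissonMeasure]
  simpa using (hasSum_poisson_moment_one r).tsum_eq

lemma integral_poisson_sq (r : ℝ≥0) :
    ∫ k : ℕ, (k : ℝ) ^ 2 ∂(poissonMeasure r) = r ^ 2 + r := by
  rw [integral_poissonMeasure]
  simpa using (hasSum_poisson_moment_two r).tsum_eq

/-- The law of a Poisson variable of rate `1 / n`, centered and scaled to unit variance. -/
noncomputable def stdPoisson (n : ℕ) : Measure ℝ :=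
  (poissonMeasure (1 / n : ℝ≥0)).map (fun k : ℕ => √n * ((k : ℝ) - 1 / n))

instance (n : ℕ) : IsProbabilityMeasure (stdPoisson n) :=
  Measure.isProbabilityMeasure_map (Measurable.of_discrete).aemeasurable

lemma charFun_stdPoisson (n : ℕ) (t : ℝ) :
    charFun (stdPoisson n) t = Complex.exp (1 / n *
      (Complex.exp ((√n * t : ℝ) * Complex.I) - 1) - (√n * t / n : ℝ) * Complex.I) := by
  have h : stdPoisson n = (((poissonMeasure (1 / n : ℝ≥0)).map (Nat.cast : ℕ → ℝ)).map
      (fun x => x + (-(1 / n) : ℝ))).map (fun x => √n * x) := by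
    rw [Measure.map_map (by fun_prop) (by fun_prop), Measure.map_map (by fun_prop) (by fun_prop)]
    rfl
  rw [h, charFun_map_mul, charFun_map_add_const, charFun_map_cast_poissonMeasure,
    ← Complex.exp_add]
  congr 1
  simp
  ring

lemma isNormalizedRoot_stdPoisson {n : ℕ} (hn : 0 < n) :
    IsNormalizedRoot n (stdPoisson n) (stdPoisson 1) where
  isProbabilityMeasure := inferInstance
  memLp := by
    rw [stdPoisson, memLp_map_measure_iff (by fun_prop) (by fun_prop)]
    refine MemLp.const_mul (MemLp.sub ?_ (memLp_const _)) _
    rw [memLp_two_iff_integrable_sq (by fun_prop)]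
    exact integrable_poisson_sq _
  integral_id := by
    rw [stdPoisson, integral_map (by fun_prop) (by fun_prop), integral_const_mul,
      integral_sub (integrable_poisson_id _) (integrable_const _), integral_poisson_id]
    simp
  integral_sq := by
    have hn' : (n : ℝ) ≠ 0 := by positivity
    rw [stdPoisson, integral_map (by fun_prop) (by fun_prop)]
    have h : ∀ k : ℕ, (√(n : ℝ) * ((k : ℝ) - 1 / n)) ^ 2 =
        n * (k : ℝ) ^ 2 - 2 * k + 1 / n := by
      intro k
      rw [mul_pow, Real.sq_sqrt (by positivity)]
      field_simp
      ring
    simp only [h]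
    have h1 : Integrable (fun k : ℕ => (n : ℝ) * (k : ℝ) ^ 2 - 2 * k)
        (poissonMeasure (1 / n : ℝ≥0)) :=
      ((integrable_poisson_sq _).const_mul _).sub ((integrable_poisson_id _).const_mul _)
    rw [integral_add h1 (integrable_const _),
      integral_sub ((integrable_poisson_sq _).const_mul _) ((integrable_poisson_id _).const_mul _),
      integral_const_mul, integral_const_mul, integral_poisson_id, integral_poisson_sq]
    simp
    field_simp
    ring
  charFun_pow t := by
    have hn' : (n : ℂ) ≠ 0 := by exact_mod_cast hn.ne'
    have hs : √(n : ℝ) * ((√n)⁻¹ * t) = t := by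
      rw [mul_inv_cancel_left₀]; positivity
    rw [charFun_stdPoisson, charFun_stdPoisson, ← Complex.exp_nat_mul, hs]
    congr 1
    simp
    field_simp

/-- The two limit laws differ: the centered Poisson law has an atom. -/
lemma gaussianReal_ne_stdPoisson : gaussianReal 0 1 ≠ stdPoisson 1 := by
  intro h
  have h1 : gaussianReal 0 1 {(-1 : ℝ)} = 0 := by
    have := nullSingletonClass_gaussianReal (μ := 0) (v := 1) one_ne_zero
    exact measure_singleton _
  have h2 : stdPoisson 1 {(-1 : ℝ)} ≠ 0 := by
    rw [stdPoisson, Measure.map_apply (by fun_prop) (measurableSet_singleton _)]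
    have h3 : 0 < poissonMeasure ((1 / (1 : ℕ) : ℝ≥0)) {0} := by
      rw [poissonMeasure_singleton]
      simp [Real.exp_pos]
    refine (h3.trans_le (measure_mono ?_)).ne'
    simp
  exact h2 (h ▸ h1)

/-! ### The two-sided Bernoulli shift -/

section Shift

variable {X : Type*} [MeasurableSpace X]

/-- The left shift on bi-infinite sequences. -/
def shift (X : Type*) [MeasurableSpace X] : (ℤ → X) ≃ᵐ (ℤ → X) where
  toFun ω i := ω (i + 1)
  invFun ω i := ω (i - 1)
  left_inv ω := by simp
  right_inv ω := by simp
  measurable_toFun := by simp only [Equiv.coe_fn_mk]; fun_prop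
  measurable_invFun := by simp only [Equiv.coe_fn_symm_mk]; fun_prop

lemma shift_apply (ω : ℤ → X) (i : ℤ) : shift X ω i = ω (i + 1) := rfl

lemma iterate_shift_apply (l : ℕ) (ω : ℤ → X) (i : ℤ) : (shift X)^[l] ω i = ω (i + l) := by
  induction l generalizing i with
  | zero => simp
  | succ l ih =>
    rw [Function.iterate_succ_apply', shift_apply, ih]
    congr 1; push_cast; ring

/-- The σ-algebra generated by the coordinates in a set of times. -/
abbrev coordAlgebra (X : Type*) [MeasurableSpace X] (s : Set ℤ) : MeasurableSpace (ℤ → X) :=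
  ⨆ j ∈ s, MeasurableSpace.comap (fun ω => ω j) inferInstance

lemma coordAlgebra_le (s : Set ℤ) : coordAlgebra X s ≤ MeasurableSpace.pi :=
  iSup₂_le fun j _ => (measurable_pi_apply j).comap_le

lemma coordAlgebra_mono {s t : Set ℤ} (h : s ⊆ t) : coordAlgebra X s ≤ coordAlgebra X t :=
  biSup_mono h

lemma measurable_coord {s : Set ℤ} {j : ℤ} (hj : j ∈ s) :
    Measurable[coordAlgebra X s] (fun ω : ℤ → X => ω j) :=
  Measurable.mono (comap_measurable _)
    (le_iSup₂ (f := fun j (_ : j ∈ s) => MeasurableSpace.comap (fun ω : ℤ → X => ω j) inferInstance)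
      j hj) le_rfl

lemma comap_shift_coordAlgebra (i : ℤ) :
    MeasurableSpace.comap (shift X) (coordAlgebra X (Set.Iic i)) =
      coordAlgebra X (Set.Iic (i + 1)) := by
  simp only [coordAlgebra, MeasurableSpace.comap_iSup, MeasurableSpace.comap_comp]
  apply le_antisymm
  · exact iSup₂_le fun j hj => le_iSup₂ (f := fun j (_ : j ∈ Set.Iic (i + 1)) =>
      MeasurableSpace.comap (fun ω : ℤ → X => ω j) inferInstance) (j + 1) (by simpa using hj)
  · refine iSup₂_le fun j hj => ?_
    have h := le_iSup₂ (f := fun j (_ : j ∈ Set.Iic i) =>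
      MeasurableSpace.comap ((fun ω : ℤ → X => ω j) ∘ shift X) inferInstance) (j - 1)
      (by simp only [Set.mem_Iic] at hj ⊢; omega)
    refine le_trans (le_of_eq ?_) h
    congr 1
    ext ω
    simp [shift_apply]

/-- The filtration of the past of the coordinate process. -/
def pastFiltration (X : Type*) [MeasurableSpace X] :
    Filtration ℤ (MeasurableSpace.pi : MeasurableSpace (ℤ → X)) where
  seq i := coordAlgebra X (Set.Iic i)
  mono' _ _ h := coordAlgebra_mono (Set.Iic_subset_Iic.2 h)
  le' _ := coordAlgebra_le _

variable (P : Measure X) [IsProbabilityMeasure P]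

lemma iIndepFun_coord :
    iIndepFun (fun (i : ℤ) (ω : ℤ → X) => ω i) (Measure.infinitePi fun _ => P) :=
  iIndepFun_infinitePi (P := fun _ : ℤ => P) (X := fun _ x => x) fun _ => measurable_id

lemma indep_coordAlgebra {s t : Set ℤ} (hst : Disjoint s t) :
    Indep (coordAlgebra X s) (coordAlgebra X t) (Measure.infinitePi fun _ => P) :=
  indep_iSup_of_disjoint (fun j => (measurable_pi_apply j).comap_le) (iIndepFun_coord P) hst

lemma measurePreserving_shift :
    MeasurePreserving (shift X) (Measure.infinitePi fun _ => P) (Measure.infinitePi fun _ => P) :=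
  ⟨(shift X).measurable, Measure.map_infinitePi_infinitePi_of_inj (P := fun _ : ℤ => P)
    (f := fun i : ℤ => i + 1) (add_left_injective 1)⟩

lemma exists_window_of_mem_measurableCylinders {B : Set (ℤ → X)}
    (hB : B ∈ measurableCylinders fun _ : ℤ => X) :
    ∃ n : ℕ, MeasurableSet[coordAlgebra X (Set.Icc (-(n : ℤ)) n)] B := by
  obtain ⟨s, S, hS, rfl⟩ := (mem_measurableCylinders B).1 hB
  set n : ℕ := s.sup Int.natAbs with hn
  refine ⟨n, ?_⟩
  have h : Measurable[coordAlgebra X (Set.Icc (-(n : ℤ)) n)]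
      (s.restrict : (ℤ → X) → (s → X)) := by
    refine (@measurable_pi_iff _ _ _ (coordAlgebra X _) _ _).2 fun j => measurable_coord ?_
    have := Finset.le_sup (f := Int.natAbs) j.2
    rw [← hn] at this
    simp only [Set.mem_Icc]
    omega
  exact h hS

/-- A cylinder is independent of its preimage under a high enough power of the shift. -/
lemma exists_measure_inter_preimage_iterate {B : Set (ℤ → X)}
    (hB : B ∈ measurableCylinders fun _ : ℤ => X) :
    ∃ m : ℕ, (Measure.infinitePi fun _ => P) (B ∩ (shift X)^[m] ⁻¹' B) =
      (Measure.infinitePi fun _ => P) B * (Measure.infinitePi fun _ => P) B := by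
  obtain ⟨n, hn⟩ := exists_window_of_mem_measurableCylinders hB
  set s : Set ℤ := Set.Icc (-(n : ℤ)) n
  set t : Set ℤ := Set.Icc ((n : ℤ) + 1) (3 * n + 1)
  refine ⟨2 * n + 1, ?_⟩
  have hmeas : Measurable[coordAlgebra X t, coordAlgebra X s] ((shift X)^[2 * n + 1]) := by
    rw [measurable_iff_comap_le, coordAlgebra]
    simp only [MeasurableSpace.comap_iSup, MeasurableSpace.comap_comp]
    refine iSup₂_le fun j hj => ?_
    have : ((fun ω : ℤ → X => ω j) ∘ (shift X)^[2 * n + 1]) =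
        fun ω => ω (j + (2 * n + 1 : ℕ)) := by
      ext ω; exact iterate_shift_apply _ _ _
    rw [this]
    refine (measurable_coord ?_).comap_le
    simp only [s, t, Set.mem_Icc] at hj ⊢
    push_cast
    omega
  have hst : Disjoint s t := by
    rw [Set.disjoint_left]
    intro j hj hj'
    simp only [s, t, Set.mem_Icc] at hj hj'
    omega
  have h := (Indep_iff _ _ _).1 (indep_coordAlgebra P hst) _ _ hn (hmeas hn)
  rw [h, ((measurePreserving_shift P).iterate _).measure_preimage
    (MeasurableSet.of_mem_measurableCylinders hB).nullMeasurableSet]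

/-- The Bernoulli shift is ergodic. An invariant set is approximated by a cylinder `B`, hence also
by `B ∩ T⁻ᵐ B`, whose measure is `μ(B)²`; so the measure of the invariant set is its own square. -/
lemma ergodic_shift : Ergodic (shift X) (Measure.infinitePi fun _ => P) := by
  refine ⟨measurePreserving_shift P, ⟨fun A hA hinv => ?_⟩⟩
  set μ := Measure.infinitePi (fun _ : ℤ => P)
  have hdense : μ.MeasureDense (measurableCylinders fun _ : ℤ => X) :=
    Measure.MeasureDense.of_generateFrom_isSetAlgebra_finite μ
      isSetAlgebra_measurableCylinders generateFrom_measurableCylinders.symm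
  have hsq : μ.real A = μ.real A * μ.real A := by
    refine eq_of_forall_dist_le fun ε hε => ?_
    obtain ⟨B, hB, hAB⟩ := hdense.approx A hA (measure_ne_top _ _) (ε / 4) (by positivity)
    have hBm : MeasurableSet B := (MeasurableSet.of_mem_measurableCylinders hB)
    obtain ⟨m, hm⟩ := exists_measure_inter_preimage_iterate P hB
    have hm' : μ.real (B ∩ (shift X)^[m] ⁻¹' B) = μ.real B * μ.real B := by
      simp only [measureReal_def, hm, ENNReal.toReal_mul, μ]
    have hd : μ.real (symmDiff A B) ≤ ε / 4 := by
      rw [measureReal_def]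
      exact ENNReal.toReal_le_of_le_ofReal (by positivity) hAB.le
    have hTm := (measurePreserving_shift P).iterate m
    have hAm : (shift X)^[m] ⁻¹' A = A := Set.preimage_iterate_eq ▸ Function.IsFixedPt.iterate hinv m
    have hd2 : μ.real (symmDiff A ((shift X)^[m] ⁻¹' B)) ≤ ε / 4 := by
      have : symmDiff A ((shift X)^[m] ⁻¹' B) = (shift X)^[m] ⁻¹' (symmDiff A B) := by
        rw [Set.preimage_symmDiff, hAm]
      rw [this, hTm.measureReal_preimage (hA.symmDiff hBm).nullMeasurableSet]
      exact hd
    have h1 : |μ.real A - μ.real B| ≤ ε / 4 :=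
      (abs_measureReal_sub_le_measureReal_symmDiff
      hA.nullMeasurableSet hBm.nullMeasurableSet).trans hd
    have h2 : |μ.real A - μ.real (B ∩ (shift X)^[m] ⁻¹' B)| ≤ ε / 4 + ε / 4 := by
      refine (abs_measureReal_sub_le_measureReal_symmDiff hA.nullMeasurableSet
        (hBm.inter (hTm.measurable hBm)).nullMeasurableSet).trans ?_
      refine (measureReal_mono ?_).trans ((measureReal_union_le _ _).trans (add_le_add hd hd2))
      intro x hx
      simp only [Set.mem_symmDiff, Set.mem_union, Set.mem_inter_iff] at hx ⊢
      tauto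
    rw [hm'] at h2
    have hA0 : 0 ≤ μ.real A := measureReal_nonneg
    have hB0 : 0 ≤ μ.real B := measureReal_nonneg
    have hA1 : μ.real A ≤ 1 := measureReal_le_one
    have hB1 : μ.real B ≤ 1 := measureReal_le_one
    rw [Real.dist_eq]
    rw [abs_le] at h1 h2 ⊢
    constructor <;> nlinarith
  have h01 : μ.real A = 0 ∨ μ.real A = 1 := by
    rcases eq_or_ne (μ.real A) 0 with h | h
    · exact Or.inl h
    · exact Or.inr ((mul_left_cancel₀ h (by rw [mul_one]; exact hsq.symm)))
  rw [eventuallyConst_set']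
  rcases h01 with h | h
  · left
    rw [ae_eq_empty]
    simpa [measureReal_def, ENNReal.toReal_eq_zero_iff] using h
  · right
    rw [ae_eq_univ, prob_compl_eq_zero_iff hA]
    rwa [measureReal_def, ENNReal.toReal_eq_one_iff] at h

end Shift

/-! ### Partial sums as operators on the space of square-integrable functions -/

section Koopman

variable {Ω : Type*} [mΩ : MeasurableSpace Ω] {μ : Measure Ω} {T : Ω → Ω} {g h : Ω → ℝ}

/-- The Koopman operator `g ↦ g ∘ T` on the space of square-integrable functions. -/
noncomputable def koopman (hT : MeasurePreserving T μ μ) : Lp ℝ 2 μ →L[ℝ] Lp ℝ 2 μ :=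
  (Lp.compMeasurePreservingₗᵢ ℝ T hT).toContinuousLinearMap

lemma norm_koopman (hT : MeasurePreserving T μ μ) (x : Lp ℝ 2 μ) : ‖koopman hT x‖ = ‖x‖ :=
  (Lp.compMeasurePreservingₗᵢ ℝ T hT).norm_map x

lemma koopman_toLp (hT : MeasurePreserving T μ μ) (hg : MemLp g 2 μ) :
    koopman hT (hg.toLp g) = (hg.comp_measurePreserving hT).toLp (g ∘ T) := rfl

lemma koopman_pow_toLp (hT : MeasurePreserving T μ μ) (hg : MemLp g 2 μ) (l : ℕ) :
    (koopman hT ^ l) (hg.toLp g) = (hg.comp_measurePreserving (hT.iterate l)).toLp (g ∘ T^[l]) := by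
  induction l with
  | zero => simp
  | succ l ih => rw [pow_succ', mul_apply_eq_comp, ih, koopman_toLp]; rfl

lemma memLp_birkhoffSum (hT : MeasurePreserving T μ μ) (hg : MemLp g 2 μ) (n : ℕ) :
    MemLp (birkhoffSum T g n) 2 μ :=
  memLp_finsetSum (Finset.range n) (f := fun l ω => g (T^[l] ω))
    fun l _ => hg.comp_measurePreserving (hT.iterate l)

lemma toLp_birkhoffSum (hT : MeasurePreserving T μ μ) (hg : MemLp g 2 μ) (n : ℕ) :
    (memLp_birkhoffSum hT hg n).toLp (birkhoffSum T g n) = powSum (koopman hT) n (hg.toLp g) := by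
  induction n with
  | zero =>
    simp only [powSum_apply, Finset.range_zero, Finset.sum_empty]
    rw [← MemLp.toLp_zero (μ := μ) (p := 2) (E := ℝ) MemLp.zero]
    congr 1
  | succ n ih =>
    rw [powSum_apply, Finset.sum_range_succ, ← powSum_apply, ← ih, koopman_pow_toLp,
      ← MemLp.toLp_add]
    congr 1
    ext ω
    simp [birkhoffSum_succ]

lemma inner_toLp (hg : MemLp g 2 μ) (hh : MemLp h 2 μ) :
    inner ℝ (hg.toLp g) (hh.toLp h) = ∫ ω, g ω * h ω ∂μ := by
  rw [L2.inner_def]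
  refine integral_congr_ae ?_
  filter_upwards [hg.coeFn_toLp, hh.coeFn_toLp] with ω h1 h2
  rw [h1, h2]
  simp [mul_comm]

lemma variance_eq_norm_sq (hg : MemLp g 2 μ) (h0 : ∫ ω, g ω ∂μ = 0) :
    Var[g; μ] = ‖hg.toLp g‖ ^ 2 := by
  rw [variance_of_integral_eq_zero hg.1.aemeasurable h0, ← real_inner_self_eq_norm_sq,
    inner_toLp]
  simp only [pow_two]

lemma integral_birkhoffSum_eq_zero [IsProbabilityMeasure μ] (hT : MeasurePreserving T μ μ)
    (hg : MemLp g 2 μ) (h0 : ∫ ω, g ω ∂μ = 0) (n : ℕ) : ∫ ω, birkhoffSum T g n ω ∂μ = 0 := by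
  have hcomp : ∀ l, ∫ ω, g (T^[l] ω) ∂μ = 0 := by
    intro l
    have hmap := (hT.iterate l).map_eq
    rw [← h0, ← integral_map (hT.iterate l).measurable.aemeasurable (by rw [hmap]; exact hg.1), hmap]
  simp only [birkhoffSum]
  rw [integral_finsetSum (f := fun l ω => g (T^[l] ω)) _ fun l _ =>
    ((hg.comp_measurePreserving (hT.iterate l)).integrable one_le_two)]
  exact Finset.sum_eq_zero fun l _ => hcomp l

end Koopman

section CondExp

variable {Ω : Type*} {m mΩ : MeasurableSpace Ω} {μ : Measure Ω} {g : Ω → ℝ}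

/-- Conditional expectation as a bounded operator from the space of square-integrable functions to
itself. -/
noncomputable def condExpOp (μ : Measure Ω) (hm : m ≤ mΩ) :
    Lp ℝ 2 μ →L[ℝ] Lp ℝ 2 μ :=
  (lpMeas ℝ ℝ m 2 μ).subtypeL.comp (condExpL2 ℝ ℝ hm)

lemma norm_condExpOp_le (hm : m ≤ mΩ) (x : Lp ℝ 2 μ) :
    ‖condExpOp μ hm x‖ ≤ ‖x‖ :=
  norm_condExpL2_le hm x

lemma condExpOp_toLp_ae_eq [IsFiniteMeasure μ] (hm : m ≤ mΩ)
    (hg : MemLp g 2 μ) : condExpOp μ hm (hg.toLp g) =ᵐ[μ] μ[g | m] :=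
  hg.condExpL2_ae_eq_condExp hm

lemma toReal_eLpNorm_condExp [IsFiniteMeasure μ] (hm : m ≤ mΩ)
    (hg : MemLp g 2 μ) : (eLpNorm (μ[g | m]) 2 μ).toReal = ‖condExpOp μ hm (hg.toLp g)‖ := by
  rw [Lp.norm_def, eLpNorm_congr_ae (condExpOp_toLp_ae_eq hm hg)]

end CondExp

/-! ### The array of innovations -/

section Innovations

variable (ρ : ℕ → Measure ℝ) [∀ k, IsProbabilityMeasure (ρ k)]

/-- The law of a bi-infinite i.i.d. sequence whose terms are sequences of independent variables with
laws `ρ 0, ρ 1, …`. -/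
noncomputable def arrayLaw : Measure (ℤ → ℕ → ℝ) :=
  Measure.infinitePi fun _ => Measure.infinitePi ρ

instance : IsProbabilityMeasure (arrayLaw ρ) := by unfold arrayLaw; infer_instance

lemma measurePreserving_innovation (k : ℕ) (i : ℤ) :
    MeasurePreserving (fun ω : ℤ → ℕ → ℝ => ω i k) (arrayLaw ρ) (ρ k) :=
  (measurePreserving_eval_infinitePi ρ k).comp
    (measurePreserving_eval_infinitePi (fun _ : ℤ => Measure.infinitePi ρ) i)

lemma iIndepFun_innovation :
    iIndepFun (fun (p : ℤ × ℕ) (ω : ℤ → ℕ → ℝ) => ω p.1 p.2) (arrayLaw ρ) :=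
  iIndepFun_uncurry_infinitePi' (fun (_ : ℤ) => ρ) (X := fun _ _ x => x) fun _ _ => measurable_id

lemma measurePreserving_shift_arrayLaw :
    MeasurePreserving (shift (ℕ → ℝ)) (arrayLaw ρ) (arrayLaw ρ) :=
  measurePreserving_shift _

variable {ρ} {ν : ℕ → Measure ℝ} {n : ℕ → ℕ} (hρ : ∀ k, IsNormalizedRoot (n k) (ρ k) (ν k))

include hρ

lemma memLp_innovation (k : ℕ) (i : ℤ) :
    MemLp (fun ω : ℤ → ℕ → ℝ => ω i k) 2 (arrayLaw ρ) :=
  (hρ k).memLp.comp_measurePreserving (measurePreserving_innovation ρ k i)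

lemma integral_innovation (k : ℕ) (i : ℤ) : ∫ ω, ω i k ∂(arrayLaw ρ) = 0 := by
  have h := measurePreserving_innovation ρ k i
  rw [← (hρ k).integral_id, ← h.map_eq, integral_map h.measurable.aemeasurable (by fun_prop)]

/-- The innovation of the `k`-th component at time `i`, as a vector. -/
noncomputable def innov (k : ℕ) (i : ℤ) : Lp ℝ 2 (arrayLaw ρ) :=
  (memLp_innovation hρ k i).toLp _

lemma orthonormal_innov : Orthonormal ℝ (fun p : ℕ × ℤ => innov hρ p.1 p.2) := by
  rw [orthonormal_iff_ite]
  rintro ⟨k, i⟩ ⟨k', i'⟩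
  simp only [innov]
  rw [inner_toLp]
  split_ifs with h
  · obtain ⟨rfl, rfl⟩ := Prod.mk.inj h
    have hp := measurePreserving_innovation ρ k i
    rw [← (hρ k).integral_sq, ← hp.map_eq, integral_map hp.measurable.aemeasurable (by fun_prop)]
    simp only [pow_two]
  · have hne : (i, k) ≠ (i', k') := by
      intro h'
      exact h (by simp only [Prod.mk.injEq] at h' ⊢; tauto)
    have hind := (iIndepFun_innovation ρ).indepFun hne
    have := hind.integral_mul_eq_mul_integral (memLp_innovation hρ k i).1
      (memLp_innovation hρ k' i').1
    simp only [Pi.mul_apply] at this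
    rw [this, integral_innovation hρ, zero_mul]

lemma koopman_innov (k : ℕ) (i : ℤ) :
    koopman (measurePreserving_shift_arrayLaw ρ) (innov hρ k i) = innov hρ k (i + 1) := rfl

lemma condExpOp_innov (k : ℕ) {i : ℤ} (hi : 0 < i) :
    condExpOp (arrayLaw ρ) ((pastFiltration (ℕ → ℝ)).le 0) (innov hρ k i) = 0 := by
  refine Lp.ext ?_
  refine (condExpOp_toLp_ae_eq _ (memLp_innovation hρ k i)).trans ?_
  have hdisj : Disjoint ({i} : Set ℤ) (Set.Iic 0) := by simpa using hi
  have h := condExp_indep_eq (coordAlgebra_le {i}) (coordAlgebra_le (Set.Iic 0))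
    (f := fun ω : ℤ → ℕ → ℝ => ω i k)
    ((measurable_pi_apply k).comp (measurable_coord (Set.mem_singleton i))).stronglyMeasurable
    (indep_coordAlgebra (Measure.infinitePi ρ) hdisj)
  refine h.trans ?_
  have h0 := integral_innovation hρ k i
  rw [arrayLaw] at h0
  rw [h0]
  exact (Lp.coeFn_zero _ _ _).symm

/-- The superposition of the one-sided moving averages is a function of the past. -/
lemma aestronglyMeasurable_superposition {c : ℕ → ℝ} {N : ℕ → ℕ} (hN : AdaptedScales c N) :
    AEStronglyMeasurable[pastFiltration (ℕ → ℝ) 0]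
      ((superposition (innov hρ) N : Lp ℝ 2 (arrayLaw ρ)) : (ℤ → ℕ → ℝ) → ℝ) (arrayLaw ρ) := by
  set M := lpMeas ℝ ℝ (pastFiltration (ℕ → ℝ) 0) 2 (arrayLaw ρ)
  have hmem : ∀ k, amp k • movAvg (innov hρ k) (N k) ∈ M := by
    intro k
    refine M.smul_mem _ (M.smul_mem _ (M.sum_mem fun i _ => ?_))
    rw [mem_lpMeas_iff_aestronglyMeasurable]
    have hm : StronglyMeasurable[pastFiltration (ℕ → ℝ) 0]
        (fun ω : ℤ → ℕ → ℝ => ω (-(i : ℤ)) k) :=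
      ((measurable_pi_apply k).comp (measurable_coord (s := Set.Iic 0) (by simp))).stronglyMeasurable
    exact hm.aestronglyMeasurable.congr (memLp_innovation hρ k _).coeFn_toLp.symm
  exact (isClosed_aestronglyMeasurable ((pastFiltration (ℕ → ℝ)).le 0)).mem_of_tendsto
    (hasSum_superposition (orthonormal_innov hρ) hN)
    (Eventually.of_forall fun s => mem_lpMeas_iff_aestronglyMeasurable.1
      (M.sum_mem fun k _ => hmem k))

lemma integral_superposition {c : ℕ → ℝ} {N : ℕ → ℕ} (hN : AdaptedScales c N)
    {f : (ℤ → ℕ → ℝ) → ℝ} (hf : MemLp f 2 (arrayLaw ρ))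
    (hfF : hf.toLp f = superposition (innov hρ) N) : ∫ ω, f ω ∂(arrayLaw ρ) = 0 := by
  have h1 : MemLp (fun _ : ℤ → ℕ → ℝ => (1 : ℝ)) 2 (arrayLaw ρ) := memLp_const 1
  have hL : ∀ {g : (ℤ → ℕ → ℝ) → ℝ} (hg : MemLp g 2 (arrayLaw ρ)),
      innerSL ℝ (h1.toLp _) (hg.toLp g) = ∫ ω, g ω ∂(arrayLaw ρ) := by
    intro g hg
    rw [innerSL_apply_apply, inner_toLp]
    simp
  have hv : ∀ k i, innerSL ℝ (h1.toLp _) (innov hρ k i) = 0 := by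
    intro k i
    rw [innov, hL, integral_innovation hρ]
  have hsum := (innerSL ℝ (h1.toLp _)).hasSum (hasSum_superposition (orthonormal_innov hρ) hN)
  simp only [movAvg, map_smul, map_sum, hv, Finset.sum_const_zero, smul_zero] at hsum
  rw [← hL hf, hfF]
  exact hsum.unique hasSum_zero

/-- The normalized sum of `n k` innovations of the `k`-th component has law exactly `ν k`. -/
lemma map_normalized_sum_innovation [∀ k, IsProbabilityMeasure (ν k)] (k : ℕ) :
    (arrayLaw ρ).map (fun ω => (√(n k))⁻¹ * ∑ l ∈ Finset.range (n k), ω (l : ℤ) k) = ν k := by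
  have hmeas : Measurable (fun ω : ℤ → ℕ → ℝ =>
      (√(n k))⁻¹ * ∑ l ∈ Finset.range (n k), ω (l : ℤ) k) := by fun_prop
  have := Measure.isProbabilityMeasure_map (μ := arrayLaw ρ) hmeas.aemeasurable
  refine Measure.ext_of_charFun (funext fun t => ?_)
  have hind : iIndepFun (fun (l : ℕ) (ω : ℤ → ℕ → ℝ) => ω (l : ℤ) k) (arrayLaw ρ) :=
    (iIndepFun_innovation ρ).precomp (g := fun l : ℕ => ((l : ℤ), k)) fun a b h => by simpa using h
  have hmap : ∀ i : ℤ, (arrayLaw ρ).map (fun ω : ℤ → ℕ → ℝ => ω i k) = ρ k :=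
    fun i => (measurePreserving_innovation ρ k i).map_eq
  have h := charFun_inv_sqrt_mul_sum (n := n k) (t := t) hind fun l =>
    ⟨(measurePreserving_innovation ρ k l).measurable.aemeasurable,
      (measurePreserving_innovation ρ k (0 : ℕ)).measurable.aemeasurable, by rw [hmap, hmap]⟩
  rw [h, hmap, (hρ k).charFun_pow]

end Innovations

/-! ### Limit laws along the dominating times -/

section Limit

/-- If `s` is within relative error `ε` of a positive multiple of the unit vector `y`, then
normalizing `s` gives `y` up to `2 ε`. -/
lemma norm_normalize_sub_le {H : Type*} [NormedAddCommGroup H] [NormedSpace ℝ H] {s y : H}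
    {A ε : ℝ} (hA : 0 < A) (hy : ‖y‖ = 1) (h : ‖s - A • y‖ ≤ ε * A) :
    ‖(‖s‖)⁻¹ • s - y‖ ≤ 2 * ε := by
  have hAy : ‖A • y‖ = A := by rw [norm_smul, hy, mul_one, Real.norm_of_nonneg hA.le]
  have habs : |‖s‖ - A| ≤ ε * A := by
    have := abs_norm_sub_norm_le s (A • y)
    rw [hAy] at this
    exact this.trans h
  rcases eq_or_ne (‖s‖) 0 with h0 | h0
  · have hs : s = 0 := norm_eq_zero.1 h0
    rw [h0, zero_sub, abs_neg, abs_of_pos hA] at habs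
    have : 1 ≤ ε := by
      by_contra hlt
      nlinarith
    rw [hs, smul_zero, zero_sub, norm_neg, hy]
    linarith
  · have h1 : ‖A⁻¹ • s - y‖ ≤ ε := by
      have : A⁻¹ • s - y = A⁻¹ • (s - A • y) := by
        rw [smul_sub, smul_smul, inv_mul_cancel₀ hA.ne', one_smul]
      rw [this, norm_smul, norm_inv, Real.norm_of_nonneg hA.le, inv_mul_le_iff₀ hA, mul_comm]
      exact h
    have h2 : ‖(‖s‖)⁻¹ • s - A⁻¹ • s‖ ≤ ε := by
      rw [← sub_smul, norm_smul]
      have : ‖(‖s‖)⁻¹ - A⁻¹‖ * ‖s‖ = |‖s‖ - A| / A := by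
        rw [Real.norm_eq_abs, inv_sub_inv h0 hA.ne', abs_div, abs_sub_comm,
          abs_of_pos (mul_pos (lt_of_le_of_ne (norm_nonneg s) h0.symm) hA)]
        field_simp
      rw [this, div_le_iff₀ hA]
      exact habs
    calc _ ≤ ‖(‖s‖)⁻¹ • s - A⁻¹ • s‖ + ‖A⁻¹ • s - y‖ := norm_sub_le_norm_sub_add_norm_sub _ _ _
      _ ≤ _ := by linarith

variable {ρ ν : ℕ → Measure ℝ} [∀ k, IsProbabilityMeasure (ρ k)] [∀ k, IsProbabilityMeasure (ν k)]
  {c : ℕ → ℝ} {N : ℕ → ℕ}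

/-- Along components sharing the limit law `ν'`, the normalized sums at the dominating times
converge to `ν'`: they are within `12 / (k + 1)` in mean square of variables with law `ν'`. -/
lemma tendstoInDistribution_domTime (hN : AdaptedScales c N)
    (hρ : ∀ k, IsNormalizedRoot (domTime N k) (ρ k) (ν k))
    {f : (ℤ → ℕ → ℝ) → ℝ} (hf : MemLp f 2 (arrayLaw ρ))
    (hfF : hf.toLp f = superposition (innov hρ) N) {k : ℕ → ℕ} (hk : StrictMono k)
    {ν' : Measure ℝ} [IsProbabilityMeasure ν'] (hν : ∀ j, ν (k j) = ν') :
    TendstoInDistribution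
      (fun j ω => birkhoffSum (shift (ℕ → ℝ)) f (domTime N (k j)) ω /
        √(Var[birkhoffSum (shift (ℕ → ℝ)) f (domTime N (k j)); arrayLaw ρ]))
      atTop (id : ℝ → ℝ) (fun _ => arrayLaw ρ) ν' := by
  set μ := arrayLaw ρ
  have hT := measurePreserving_shift_arrayLaw ρ
  set S : ℕ → (ℤ → ℕ → ℝ) → ℝ := fun j => birkhoffSum (shift (ℕ → ℝ)) f (domTime N (k j))
  set E : ℕ → (ℤ → ℕ → ℝ) → ℝ := fun j =>
    birkhoffSum (shift (ℕ → ℝ)) (fun ω => ω 0 (k j)) (domTime N (k j))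
  have hS : ∀ j, MemLp (S j) 2 μ := fun j => memLp_birkhoffSum hT hf _
  have hE : ∀ j, MemLp (E j) 2 μ := fun j => memLp_birkhoffSum hT (memLp_innovation hρ _ _) _
  have hE_eq : ∀ j ω, E j ω = ∑ l ∈ Finset.range (domTime N (k j)), ω (l : ℤ) (k j) := by
    intro j ω
    simp [E, birkhoffSum, iterate_shift_apply]
  have hvar : ∀ j, √(Var[S j; μ]) = ‖(hS j).toLp _‖ := by
    intro j
    rw [variance_eq_norm_sq (hS j) (integral_birkhoffSum_eq_zero hT hf
      (integral_superposition hρ hN hf hfF) _), Real.sqrt_sq (norm_nonneg _)]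
  set X : ℕ → (ℤ → ℕ → ℝ) → ℝ := fun j ω => (√(domTime N (k j)))⁻¹ * E j ω
  set Y : ℕ → (ℤ → ℕ → ℝ) → ℝ := fun j ω => S j ω / √(Var[S j; μ])
  have hX : ∀ j, MemLp (X j) 2 μ := fun j => (hE j).const_mul _
  have hY : ∀ j, MemLp (Y j) 2 μ := fun j => by
    simp only [Y, div_eq_inv_mul]; exact (hS j).const_mul _
  have hXlaw : ∀ j, μ.map (X j) = ν' := by
    intro j
    rw [← hν j, ← map_normalized_sum_innovation hρ (k j)]
    simp only [X, hE_eq, μ]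
  have hnorm : ∀ j, ‖(hY j).toLp _ - (hX j).toLp _‖ ≤ 2 * (6 / ((k j : ℝ) + 1)) := by
    intro j
    have hn : 0 < √(domTime N (k j) : ℝ) := Real.sqrt_pos.2 (by exact_mod_cast hN.domTime_pos _)
    have h1 : (hY j).toLp _ = (‖(hS j).toLp _‖)⁻¹ • (hS j).toLp _ := by
      rw [← hvar j, ← MemLp.toLp_const_smul]
      congr 1
      ext ω
      simp [Y, div_eq_inv_mul]
    have h2 : (hX j).toLp _ = (√(domTime N (k j)))⁻¹ • (hE j).toLp _ := by
      rw [← MemLp.toLp_const_smul]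
      congr 1
    have hSp : (hS j).toLp _ = powSum (koopman hT) (domTime N (k j)) (superposition (innov hρ) N) := by
      rw [← hfF]; exact toLp_birkhoffSum hT hf _
    have hEp : (hE j).toLp _ = powSum (koopman hT) (domTime N (k j)) (innov hρ (k j) 0) :=
      toLp_birkhoffSum hT (memLp_innovation hρ _ _) _
    rw [h1, h2]
    refine norm_normalize_sub_le (mul_pos (amp_pos (k j)) hn) ?_ ?_
    · rw [hEp, norm_smul, norm_powSum_shift (orthonormal_row (orthonormal_innov hρ) (k j))
        (koopman_innov hρ (k j)), norm_inv, Real.norm_of_nonneg hn.le, inv_mul_cancel₀ hn.ne']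
    · rw [smul_smul, mul_assoc, mul_inv_cancel₀ hn.ne', mul_one, hSp, hEp]
      exact norm_powSum_superposition_sub_le (orthonormal_innov hρ) (koopman_innov hρ)
        (norm_koopman hT) hN (k j)
  have hlim : Tendsto (fun j => 2 * (6 / ((k j : ℝ) + 1))) atTop (𝓝 0) := by
    have h1 : Tendsto (fun j => ((k j : ℝ) + 1)) atTop atTop :=
      tendsto_atTop_add_const_right _ _ (tendsto_natCast_atTop_atTop.comp hk.tendsto_atTop)
    simpa using (h1.const_div_atTop 6).const_mul 2
  refine tendstoInDistribution_of_tendstoInMeasure_sub (X := X) Y id ?_ ?_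
    fun j => (hY j).1.aemeasurable
  · have hid : ∀ j, IdentDistrib (X j) (id : ℝ → ℝ) μ ν' := fun j =>
      ⟨(hX j).1.aemeasurable, aemeasurable_id, by rw [hXlaw, Measure.map_id]⟩
    exact tendstoInDistribution_of_identDistrib 0 (fun j => (hid 0).trans (hid j).symm) (hid 0)
  · refine tendstoInMeasure_of_tendsto_eLpNorm (p := 2) (by norm_num)
      (fun j => ((hY j).sub (hX j)).1) aestronglyMeasurable_zero ?_
    have heq : ∀ j, eLpNorm ((Y - X) j - 0) 2 μ =
        ENNReal.ofReal ‖(hY j).toLp _ - (hX j).toLp _‖ := by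
      intro j
      rw [← MemLp.toLp_sub, Lp.norm_toLp, ENNReal.ofReal_toReal ((hY j).sub (hX j)).2.ne, sub_zero]
      rfl
    refine Tendsto.congr (fun j => (heq j).symm) ?_
    rw [← ENNReal.ofReal_zero]
    exact ENNReal.tendsto_ofReal (squeeze_zero (fun _ => norm_nonneg _) hnorm hlim)

end Limit

end SlowScale

open SlowScale in
theorem theorem2 (c : ℕ → ℝ) (hc_pos : ∀ n : ℕ, 1 ≤ n → 0 < c n)
    (hc_lim : Tendsto c atTop (𝓝 0)) :
    ∃ (Ω : Type) (mΩ : MeasurableSpace Ω) (μ : Measure Ω) (_ : IsProbabilityMeasure μ)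
      (T : Ω ≃ᵐ Ω) (F : Filtration ℤ mΩ) (f : Ω → ℝ),
      -- the dynamical system: `T` is bijective, bimeasurable, measure preserving and ergodic
      Ergodic T μ ∧
      -- the filtration satisfies `T⁻¹ F_i = F_{i+1}`
      (∀ i : ℤ, MeasurableSpace.comap T (F i) = F (i + 1)) ∧
      -- `f` is `F_0`-measurable, square integrable, with zero mean
      Measurable[F 0] f ∧ MemLp f 2 μ ∧ (∫ ω, f ω ∂μ) = 0 ∧
      -- the weakened series, summed over the indices `n + 1 ≥ 1`, converges
      Summable (fun n : ℕ =>
        c (n + 1) * ((eLpNorm (μ[birkhoffSum T f (n + 1) | F 0]) 2 μ).toReal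
          / ((n + 1 : ℕ) : ℝ) ^ (3 / 2 : ℝ))) ∧
      -- the variances grow faster than linearly
      Tendsto (fun n : ℕ => Var[birkhoffSum T f n; μ] / (n : ℝ)) atTop atTop ∧
      -- two subsequences of the normalized partial sums have different limits in law
      ∃ (n' n'' : ℕ → ℕ) (ν' ν'' : Measure ℝ)
        (_ : IsProbabilityMeasure ν') (_ : IsProbabilityMeasure ν''),
        StrictMono n' ∧ StrictMono n'' ∧ ν' ≠ ν'' ∧
        TendstoInDistribution
          (fun k ω => birkhoffSum T f (n' k) ω / √(Var[birkhoffSum T f (n' k); μ]))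
          atTop (id : ℝ → ℝ) (fun _ => μ) ν' ∧
        TendstoInDistribution
          (fun k ω => birkhoffSum T f (n'' k) ω / √(Var[birkhoffSum T f (n'' k); μ]))
          atTop (id : ℝ → ℝ) (fun _ => μ) ν'' := by
  obtain ⟨N, hN⟩ := exists_adaptedScales hc_pos hc_lim
  let ν : ℕ → Measure ℝ := fun k => if Even k then gaussianReal 0 1 else stdPoisson 1
  let ρ : ℕ → Measure ℝ := fun k => if Even k then gaussianReal 0 1 else stdPoisson (domTime N k)
  have hρ : ∀ k, IsNormalizedRoot (domTime N k) (ρ k) (ν k) := by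
    intro k
    simp only [ρ, ν]
    split_ifs
    · exact isNormalizedRoot_gaussianReal (hN.domTime_pos k)
    · exact isNormalizedRoot_stdPoisson (hN.domTime_pos k)
  have hρprob : ∀ k, IsProbabilityMeasure (ρ k) := fun k => (hρ k).isProbabilityMeasure
  have hνprob : ∀ k, IsProbabilityMeasure (ν k) := by
    intro k
    simp only [ν]
    split_ifs <;> infer_instance
  have hT := measurePreserving_shift_arrayLaw ρ
  have hv := orthonormal_innov hρ
  have hmeas := aestronglyMeasurable_superposition hρ hN
  -- The superposition is an almost everywhere class: `f` is a representative measurable with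
  -- respect to the past.
  set f := hmeas.mk _
  have hfae : ((superposition (innov hρ) N : Lp ℝ 2 (arrayLaw ρ)) : (ℤ → ℕ → ℝ) → ℝ) =ᵐ[arrayLaw ρ] f :=
    hmeas.ae_eq_mk
  have hf : MemLp f 2 (arrayLaw ρ) := (memLp_congr_ae hfae).1 (Lp.memLp _)
  have hfF : hf.toLp f = superposition (innov hρ) N :=
    Lp.ext (hf.coeFn_toLp.trans hfae.symm)
  have hf0 : ∫ ω, f ω ∂(arrayLaw ρ) = 0 := integral_superposition hρ hN hf hfF
  refine ⟨ℤ → ℕ → ℝ, inferInstance, arrayLaw ρ, inferInstance, shift (ℕ → ℝ),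
    pastFiltration (ℕ → ℝ), f, ergodic_shift _, comap_shift_coordAlgebra,
    hmeas.stronglyMeasurable_mk.measurable, hf, hf0, ?_, ?_,
    fun j => domTime N (2 * j), fun j => domTime N (2 * j + 1), gaussianReal 0 1, stdPoisson 1,
    inferInstance, inferInstance, ?_, ?_, gaussianReal_ne_stdPoisson, ?_, ?_⟩
  · have h := summable_proj_powSum_superposition hv (koopman_innov hρ) (norm_koopman hT)
      (norm_condExpOp_le ((pastFiltration (ℕ → ℝ)).le 0))
      (fun k i hi => condExpOp_innov hρ k hi) hN hc_pos
    refine h.congr fun n => ?_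
    rw [toReal_eLpNorm_condExp ((pastFiltration (ℕ → ℝ)).le 0) (memLp_birkhoffSum hT hf _),
      toLp_birkhoffSum hT hf, hfF]
  · refine (tendsto_norm_powSum_superposition_sq_div hv (koopman_innov hρ) hN).congr fun n => ?_
    rw [variance_eq_norm_sq (memLp_birkhoffSum hT hf n)
      (integral_birkhoffSum_eq_zero hT hf hf0 n), toLp_birkhoffSum hT hf, hfF]
  · exact hN.strictMono_domTime.comp fun a b h => by omega
  · exact hN.strictMono_domTime.comp fun a b h => by omega
  · exact tendstoInDistribution_domTime hN hρ hf hfF (k := fun j => 2 * j)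
      (fun a b h => by dsimp only; omega) fun j => if_pos (by simp)
  · exact tendstoInDistribution_domTime hN hρ hf hfF (k := fun j => 2 * j + 1)
      (fun a b h => by dsimp only; omega) fun j => if_neg (by simp)
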